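/- For integers $k,s,n\ge 1$ let $r_k(s,n)$ be the minimum $N$ such that every red-blue coloring of the $k$-element subsets of an $N$-element set contains an $s$-element set all of whose $k$-subsets are red or an $n$-element set all of whose $k$-subsets are blue. Let the tower function be given by $t_1(x)=x$ and $t_{i+1}(x)=2^{t_i(x)}$. Let $s(k)$ be the minimum $s$ for which $r_k(s,n)$ grows in $n$ at least like a tower of height $k-1$, in the sense that there are $c>0$ and $n_0$ (which may depend on $k$ and $s$) with $r_k(s,n)\ge t_{k-1}(c\,n\log n)$ for all $n\ge n_0$ (and $s(k)=\infty$ if there is no such $s$). Then: 1. There is an absolute constant $c>0$ such that for all $k\ge 4$, all $s\ge\lceil \tfrac52 k\rceil-3$ and all $n\ge 3k$, $$r_k(s,n)\ \ge\ t_{k-1}(c\,n\log n).$$ 2. Consequently $s(k)\le\lceil\tfrac52 k\rceil-3$ for all $k\ge4$; in particular $s(4)\le 7$. 3. For all $k\ge 4$, $s(k+1)\le s(k)+3$, and if moreover $k$ is odd, then $s(k+1)\le s(k)+2$. -/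

import Mathlib

/-- The tower function: `tower 1 x = x` and `tower (i + 1) x = 2 ^ tower i x` for `i ≥ 1`
(the value at index `0` is a convention and is not used). -/
noncomputable def tower : ℕ → ℝ → ℝ
  | 0, x => x
  | 1, x => x
  | (i + 2), x => (2 : ℝ) ^ tower (i + 1) x

/-- The off-diagonal partition relation `N → (s, n)^k` for two colors: for every red-blue coloring
of the `k`-element subsets of an `N`-element set (red is `true`, blue is `false`; the values of
`χ` on sets of other sizes play no role) there is an `s`-element set all of whose `k`-element
subsets are red, or an `n`-element set all of whose `k`-element subsets are blue. -/
def RamseyArrow (N k s n : ℕ) : Prop :=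
  ∀ χ : Finset (Fin N) → Bool,
    (∃ A : Finset (Fin N), A.card = s ∧ ∀ e : Finset (Fin N), e ⊆ A → e.card = k → χ e = true) ∨
    (∃ A : Finset (Fin N), A.card = n ∧ ∀ e : Finset (Fin N), e ⊆ A → e.card = k → χ e = false)

/-- The off-diagonal hypergraph Ramsey number `r_k(s, n)`: the minimum `N` with
`N → (s, n)^k`. -/
noncomputable def ramseyNumber (k s n : ℕ) : ℕ :=
  sInf {N : ℕ | RamseyArrow N k s n}

/-- `r_k(s, n)` grows in `n` at least like a tower of height `k - 1`: there are `c > 0` and `n₀`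
with `r_k(s, n) ≥ t_{k-1}(c n log n)` for all `n ≥ n₀`. -/
def GrowsAsTower (k s : ℕ) : Prop :=
  ∃ c : ℝ, 0 < c ∧ ∃ n₀ : ℕ, ∀ n : ℕ, n₀ ≤ n →
    tower (k - 1) (c * n * Real.log n) ≤ (ramseyNumber k s n : ℝ)

/-- `s(k)`: the minimum `s` for which `r_k(s, n)` grows in `n` at least like a tower of height
`k - 1`; it is `⊤` if there is no such `s`. -/
noncomputable def towerThreshold (k : ℕ) : ℕ∞ :=
  ⨅ (s : ℕ) (_ : GrowsAsTower k s), (s : ℕ∞)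

/-! The proof is a variant of Erdős–Hajnal stepping up. Let δ(a, b) be the highest binary digit in
which a and b differ. A (k+1)-subset of [0, 2^N) has k consecutive differences. If they are
monotone, it inherits the color of the k-set they form. Otherwise the first local extremum decides:
red for a maximum at an even position or a minimum at an odd one, positions counted from 0.

Shifting a window by one flips the parity of its first extremum, hence the color. So in a
monochromatic set the differences can turn only near the two ends, and a long monotone run remains.
`Forces` isolates this statement about up-down sequences. For k ≥ 4 the loss is 3, and for odd k it
is 2 (`forces_add_three`, `forces_add_two`). `exists_mono_set_of_stepUp` turns a run of n
differences into an n-set monochromatic for the original coloring. Thus failure of N → (s, n)^k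
gives failure of 2^N → (s + d, n + d)^(k+1), which yields part 3.

For k = 3 the windows are too short for this, but the sequence can turn only once (`forces_three`),
so (4, m) becomes (7, 2m - 1). Starting from 7 at k = 4, the alternating increments 3 and 2 add up
to ⌈5k/2⌉ - 3.

The base is r_3(4, m) ≥ 2^(c m log m). Color pairs at random by the vertices of a triangle-free
graph with small independence number, and make u < v < w red when the colors of uv and uw are
adjacent. A red 4-set gives a triangle, and a large blue set gives a large independent set. -/

/-! ### Ramsey numbers: existence and monotonicity. -/

/-- A version of `RamseyArrow` for colorings of finite sets of natural numbers. -/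
theorem ramseyArrow_iff_nat (N k s n : ℕ) : RamseyArrow N k s n ↔
    ∀ χ : Finset ℕ → Bool,
      (∃ A ⊆ Finset.range N, A.card = s ∧ ∀ e ⊆ A, e.card = k → χ e = true) ∨
      (∃ A ⊆ Finset.range N, A.card = n ∧ ∀ e ⊆ A, e.card = k → χ e = false) := by
  constructor
  · intro h χ
    have key : ∀ (m : ℕ) (b : Bool), (∃ A : Finset (Fin N), A.card = m ∧
        ∀ e : Finset (Fin N), e ⊆ A → e.card = k → χ (e.map Fin.valEmbedding) = b) →
        ∃ A ⊆ Finset.range N, A.card = m ∧ ∀ e ⊆ A, e.card = k → χ e = b := by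
      rintro m b ⟨A, hA, hχ⟩
      refine ⟨A.map Fin.valEmbedding, ?_, by simpa using hA, ?_⟩
      · intro x hx
        obtain ⟨y, _, rfl⟩ := Finset.mem_map.1 hx
        simp
      · intro e he hc
        obtain ⟨e', he', rfl⟩ := Finset.subset_map_iff.1 he
        exact hχ e' he' (by simpa using hc)
    exact (h fun e => χ (e.map Fin.valEmbedding)).imp (key s true) (key n false)
  · intro h χ
    have key : ∀ (m : ℕ) (b : Bool), (∃ A ⊆ Finset.range N, A.card = m ∧
        ∀ e ⊆ A, e.card = k → χ (Finset.univ.filter fun i : Fin N => (i : ℕ) ∈ e) = b) →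
        ∃ A : Finset (Fin N), A.card = m ∧
          ∀ e : Finset (Fin N), e ⊆ A → e.card = k → χ e = b := by
      rintro m b ⟨A, hAN, hA, hχ⟩
      refine ⟨Finset.univ.filter fun i : Fin N => (i : ℕ) ∈ A, ?_, ?_⟩
      · rw [← hA, ← Finset.card_map Fin.valEmbedding]
        congr 1
        ext x
        simp only [Finset.mem_map, Finset.mem_filter, Finset.mem_univ, true_and,
          Fin.valEmbedding_apply]
        constructor
        · rintro ⟨y, hy, rfl⟩
          exact hy
        · intro hx
          exact ⟨⟨x, Finset.mem_range.1 (hAN hx)⟩, hx, rfl⟩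
      · intro e he hc
        have := hχ (e.map Fin.valEmbedding) (by
          intro x hx
          obtain ⟨y, hy, rfl⟩ := Finset.mem_map.1 hx
          exact (Finset.mem_filter.1 (he hy)).2) (by simpa using hc)
        rw [← this]
        congr 1
        ext x
        simp [Fin.val_inj]
    exact (h fun e => χ (Finset.univ.filter fun i : Fin N => (i : ℕ) ∈ e)).imp
      (key s true) (key n false)

/-- Ramsey's theorem for two colors. -/
theorem exists_ramsey (k : ℕ) : ∀ s n : ℕ, ∃ N : ℕ, ∀ V : Finset ℕ, N ≤ V.card →
    ∀ χ : Finset ℕ → Bool,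
      (∃ A ⊆ V, A.card = s ∧ ∀ e ⊆ A, e.card = k → χ e = true) ∨
      (∃ A ⊆ V, A.card = n ∧ ∀ e ⊆ A, e.card = k → χ e = false) := by
  induction k with
  | zero =>
    intro s n
    refine ⟨max s n, fun V hV χ => ?_⟩
    cases hχ : χ ∅ with
    | true =>
      obtain ⟨A, hAV, hA⟩ := Finset.exists_subset_card_eq ((le_max_left s n).trans hV)
      refine Or.inl ⟨A, hAV, hA, fun e _ hc => ?_⟩
      rw [Finset.card_eq_zero.1 hc, hχ]
    | false =>
      obtain ⟨A, hAV, hA⟩ := Finset.exists_subset_card_eq ((le_max_right s n).trans hV)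
      refine Or.inr ⟨A, hAV, hA, fun e _ hc => ?_⟩
      rw [Finset.card_eq_zero.1 hc, hχ]
  | succ k ih =>
    intro s
    induction s with
    | zero =>
      refine fun n => ⟨0, fun V _ χ => Or.inl ⟨∅, by simp, by simp, fun e he hc => ?_⟩⟩
      simp [Finset.subset_empty.1 he] at hc
    | succ s ihs =>
      intro n
      induction n with
      | zero =>
        refine ⟨0, fun V _ χ => Or.inr ⟨∅, by simp, by simp, fun e he hc => ?_⟩⟩
        simp [Finset.subset_empty.1 he] at hc
      | succ n ihn =>
        obtain ⟨N₁, h₁⟩ := ihs (n + 1)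
        obtain ⟨N₂, h₂⟩ := ihn
        obtain ⟨N, hN⟩ := ih N₁ N₂
        refine ⟨N + 1, fun V hV χ => ?_⟩
        obtain ⟨v, hv⟩ : V.Nonempty := Finset.card_pos.1 (by omega)
        have hins : ∀ (A : Finset ℕ) (m : ℕ) (b : Bool), A ⊆ V.erase v →
            (∀ e ⊆ A, e.card = k → χ (insert v e) = b) →
            (∃ B ⊆ A, B.card = m ∧ ∀ e ⊆ B, e.card = k + 1 → χ e = b) →
            ∃ B ⊆ V, B.card = m + 1 ∧ ∀ e ⊆ B, e.card = k + 1 → χ e = b := by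
          rintro A m b hA hl ⟨B, hBA, hB, hχ⟩
          have hvB : v ∉ B := fun h => by simpa using hA (hBA h)
          refine ⟨insert v B, ?_, by rw [Finset.card_insert_of_notMem hvB, hB], ?_⟩
          · exact Finset.insert_subset hv ((hBA.trans hA).trans (Finset.erase_subset _ _))
          · intro e he hc
            by_cases hve : v ∈ e
            · rw [← Finset.insert_erase hve]
              refine hl _ ?_ (by rw [Finset.card_erase_of_mem hve, hc]; rfl)
              exact (Finset.subset_insert_iff.1 he).trans hBA
            · exact hχ e ((Finset.subset_insert_iff_of_notMem hve).1 he) hc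
        have hwk : ∀ (A : Finset ℕ) (m : ℕ) (b : Bool), A ⊆ V.erase v →
            (∃ B ⊆ A, B.card = m ∧ ∀ e ⊆ B, e.card = k + 1 → χ e = b) →
            ∃ B ⊆ V, B.card = m ∧ ∀ e ⊆ B, e.card = k + 1 → χ e = b := by
          rintro A m b hA ⟨B, hBA, hB⟩
          exact ⟨B, (hBA.trans hA).trans (Finset.erase_subset _ _), hB⟩
        rcases hN (V.erase v) (by rw [Finset.card_erase_of_mem hv]; omega)
          (fun e => χ (insert v e)) with ⟨A, hA, hAc, hχ⟩ | ⟨A, hA, hAc, hχ⟩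
        · exact (h₁ A hAc.ge χ).imp (hins A s true hA hχ) (hwk A (n + 1) false hA)
        · exact (h₂ A hAc.ge χ).imp (hwk A (s + 1) true hA) (hins A n false hA hχ)

theorem exists_ramseyArrow (k s n : ℕ) : ∃ N, RamseyArrow N k s n := by
  obtain ⟨N, hN⟩ := exists_ramsey k s n
  exact ⟨N, (ramseyArrow_iff_nat N k s n).2 fun χ => hN _ (by simp) χ⟩

theorem RamseyArrow.mono {N N' k s s' n n' : ℕ} (h : RamseyArrow N k s n) (hN : N ≤ N')
    (hs : s' ≤ s) (hn : n' ≤ n) : RamseyArrow N' k s' n' := by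
  rw [ramseyArrow_iff_nat] at h ⊢
  have key : ∀ (m m' : ℕ) (p : Finset ℕ → Prop), m' ≤ m →
      (∃ A ⊆ Finset.range N, A.card = m ∧ ∀ e ⊆ A, e.card = k → p e) →
      ∃ A ⊆ Finset.range N', A.card = m' ∧ ∀ e ⊆ A, e.card = k → p e := by
    rintro m m' p hm ⟨A, hAN, hA, hp⟩
    obtain ⟨B, hBA, hB⟩ := Finset.exists_subset_card_eq (hm.trans hA.ge)
    exact ⟨B, (hBA.trans hAN).trans (Finset.range_mono hN), hB, fun e he => hp e (he.trans hBA)⟩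
  exact fun χ => (h χ).imp (key s s' _ hs) (key n n' _ hn)

theorem lt_ramseyNumber {N k s n : ℕ} (h : ¬ RamseyArrow N k s n) : N < ramseyNumber k s n := by
  by_contra! hle
  have h' : RamseyArrow (ramseyNumber k s n) k s n := Nat.sInf_mem (exists_ramseyArrow k s n)
  exact h (h'.mono hle le_rfl le_rfl)

theorem not_ramseyArrow_of_lt {N k s n : ℕ} (h : N < ramseyNumber k s n) :
    ¬ RamseyArrow N k s n :=
  fun hN => (Nat.notMem_of_lt_sInf h) hN

/-! ### The difference function and the step-up coloring. -/

/-- There is a function on pairs from `[0, 2 ^ N)` with the properties of the position of the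
highest binary digit in which two numbers differ. -/
theorem exists_delta (N : ℕ) : ∃ δ : ℕ → ℕ → ℕ,
    (∀ a b, a < b → b < 2 ^ N → δ a b < N) ∧
    ∀ a b c, a < b → b < c → c < 2 ^ N →
      δ a b ≠ δ b c ∧ δ a c = max (δ a b) (δ b c) := by
  induction N with
  | zero => exact ⟨fun _ _ => 0, fun a b _ _ => by omega, fun a b c _ _ _ => by omega⟩
  | succ N ih =>
    obtain ⟨δ, h₁, h₂⟩ := ih
    have hp : 2 ^ (N + 1) = 2 ^ N + 2 ^ N := by ring
    rw [hp]
    generalize 2 ^ N = M at h₁ h₂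
    -- A pair straddling the midpoint differs in the top digit `N`; a pair inside one half is
    -- handled recursively.
    refine ⟨fun a b => if b < M then δ a b else if a < M then N else δ (a - M) (b - M), ?_, ?_⟩
    · intro a b hab hb
      dsimp only
      split_ifs with h h'
      · exact (h₁ a b hab h).trans (Nat.lt_succ_self N)
      · exact Nat.lt_succ_self N
      · exact (h₁ _ _ (by omega) (by omega)).trans (Nat.lt_succ_self N)
    · intro a b c hab hbc hc
      dsimp only
      by_cases hcM : c < M
      · rw [if_pos (hbc.trans hcM), if_pos hcM, if_pos hcM]
        exact h₂ a b c hab hbc hcM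
      · by_cases hbM : b < M
        · have := h₁ a b hab hbM
          rw [if_pos hbM, if_neg hcM, if_pos hbM, if_neg hcM, if_pos (hab.trans hbM)]
          omega
        · by_cases haM : a < M
          · have := h₁ (b - M) (c - M) (by omega) (by omega)
            rw [if_neg hbM, if_neg hcM, if_neg hbM, if_neg hcM, if_pos haM, if_pos haM]
            omega
          · rw [if_neg hbM, if_neg hcM, if_neg hbM, if_neg hcM, if_neg haM, if_neg haM]
            exact h₂ _ _ _ (by omega) (by omega) (by omega)

/-- The increasing enumeration of a finite set of natural numbers. -/
noncomputable def Finset.enum (e : Finset ℕ) (j : ℕ) : ℕ :=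
  if h : j < e.card then e.orderEmbOfFin rfl ⟨j, h⟩ else 0

theorem Finset.enum_mem {e : Finset ℕ} {j : ℕ} (h : j < e.card) : e.enum j ∈ e := by
  rw [Finset.enum, dif_pos h]
  exact Finset.orderEmbOfFin_mem _ _ _

theorem Finset.enum_lt_enum {e : Finset ℕ} {i j : ℕ} (hij : i < j) (h : j < e.card) :
    e.enum i < e.enum j := by
  rw [Finset.enum, Finset.enum, dif_pos h, dif_pos (hij.trans h)]
  exact (e.orderEmbOfFin rfl).strictMono hij

theorem Finset.image_enum (e : Finset ℕ) : (Finset.range e.card).image e.enum = e := by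
  refine Finset.eq_of_subset_of_card_le ?_ ?_
  · intro x hx
    obtain ⟨j, hj, rfl⟩ := Finset.mem_image.1 hx
    exact Finset.enum_mem (Finset.mem_range.1 hj)
  · rw [Finset.card_image_of_injOn, Finset.card_range]
    intro i hi j hj hij
    simp only [Finset.coe_range, Set.mem_Iio] at hi hj
    rcases lt_trichotomy i j with h | h | h
    · exact absurd hij (Finset.enum_lt_enum h hj).ne
    · exact h
    · exact absurd hij (Finset.enum_lt_enum h hi).ne'

theorem card_image_range_of_lt {y : ℕ → ℕ} {m : ℕ} (hy : ∀ i j, i < j → j < m → y i < y j) :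
    ((Finset.range m).image y).card = m := by
  rw [Finset.card_image_of_injOn, Finset.card_range]
  intro i hi j hj hij
  simp only [Finset.coe_range, Set.mem_Iio] at hi hj
  rcases lt_trichotomy i j with h | h | h
  · exact absurd hij (hy i j h hj).ne
  · exact h
  · exact absurd hij (hy j i h hi).ne'

theorem Finset.enum_image {y : ℕ → ℕ} {m : ℕ} (hy : ∀ i j, i < j → j < m → y i < y j)
    {j : ℕ} (hj : j < m) : ((Finset.range m).image y).enum j = y j := by
  have hc := card_image_range_of_lt hy
  rw [Finset.enum, dif_pos (hj.trans_eq hc.symm)]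
  have := Finset.orderEmbOfFin_unique (s := (Finset.range m).image y) rfl
    (f := fun x => y x) (fun x => Finset.mem_image_of_mem _ (Finset.mem_range.2
      (x.2.trans_eq hc))) (fun a b hab => hy a b hab (b.2.trans_eq hc))
  exact (congrFun this ⟨j, hj.trans_eq hc.symm⟩).symm

/-- Whether a sequence goes up at an index. -/
def goesUp (D : ℕ → ℕ) (i : ℕ) : Bool := decide (D i < D (i + 1))

open Classical in
/-- The color of a tuple with difference sequence `D 0, …, D (k - 1)`: monotone sequences are
colored with `φ`, the others by the type and the parity of the position of their first local
extremum. -/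
noncomputable def stepColor (φ : Finset ℕ → Bool) (k : ℕ) (D : ℕ → ℕ) : Bool :=
  if ∀ i, i + 1 < k → goesUp D i = goesUp D 0 then φ ((Finset.range k).image D)
  else decide (∃ j, j + 1 < k ∧ (∀ i < j, goesUp D i = goesUp D 0) ∧
    goesUp D j ≠ goesUp D 0 ∧ (Even j ↔ goesUp D 0 = true))

theorem stepColor_of_monotone {φ : Finset ℕ → Bool} {k : ℕ} {D : ℕ → ℕ} (b : Bool)
    (h : ∀ i, i + 1 < k → goesUp D i = b) :
    stepColor φ k D = φ ((Finset.range k).image D) := by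
  rw [stepColor, if_pos]
  intro i hi
  rw [h i hi, h 0 (by omega)]

theorem stepColor_of_extremum {φ : Finset ℕ → Bool} {k : ℕ} {D : ℕ → ℕ} {j : ℕ} (hj : j + 1 < k)
    (h : ∀ i < j, goesUp D i = goesUp D 0) (h' : goesUp D j ≠ goesUp D 0) :
    stepColor φ k D = decide (Even j ↔ goesUp D 0 = true) := by
  rw [stepColor, if_neg (fun h₀ => h' (h₀ j hj)), decide_eq_decide]
  constructor
  · rintro ⟨i, hi, h₁, h₂, h₃⟩
    rcases lt_trichotomy i j with hij | rfl | hij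
    · exact absurd (h i hij) h₂
    · exact h₃
    · exact absurd (h₁ j hij) h'
  · exact fun h₃ => ⟨j, hj, h, h', h₃⟩

/-- The coloring of `(k + 1)`-sets obtained from a coloring `φ` of `k`-sets. -/
noncomputable def stepUpColoring (δ : ℕ → ℕ → ℕ) (φ : Finset ℕ → Bool) (k : ℕ)
    (e : Finset ℕ) : Bool :=
  stepColor φ k fun j => δ (e.enum j) (e.enum (j + 1))

theorem goesUp_congr {D D' : ℕ → ℕ} {k : ℕ} (h : ∀ j < k, D j = D' j) {i : ℕ} (hi : i + 1 < k) :
    goesUp D i = goesUp D' i := by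
  rw [goesUp, goesUp, h i (by omega), h (i + 1) hi]

/-- `Forces k M n`: an up-down sequence of length `M - 2` all of whose non-constant windows of
length `k - 1` get the same color from their first change contains a constant window of
length `n - 1`. -/
def Forces (k M n : ℕ) : Prop :=
  ∀ (γ : Bool) (u : ℕ → Bool),
    (∀ t j, t + k < M → j + 1 < k → (∀ i < j, u (t + i) = u t) → u (t + j) ≠ u t →
      decide (Even j ↔ u t = true) = γ) →
    ∃ p, p + n < M ∧ ∀ i, i + 1 < n → u (p + i) = u p

/-! ### Monotone runs of differences give monochromatic sets for the original coloring. -/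

section StepUp

variable {N M : ℕ} {δ : ℕ → ℕ → ℕ} {x : ℕ → ℕ}

theorem delta_eq_of_increasing
    (hδ : ∀ a b c, a < b → b < c → c < 2 ^ N → δ a b ≠ δ b c ∧ δ a c = max (δ a b) (δ b c))
    (hx : ∀ i j, i < j → j < M → x i < x j) (hxN : ∀ i < M, x i < 2 ^ N) {p n : ℕ}
    (hp : p + n < M) (hup : ∀ i, i + 1 < n → δ (x (p + i)) (x (p + i + 1)) <
      δ (x (p + i + 1)) (x (p + i + 2))) :
    ∀ a b, a < b → b < n + 1 →
      δ (x (p + a)) (x (p + b)) = δ (x (p + (b - 1))) (x (p + b)) := by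
  intro a b hab
  induction b, hab using Nat.le_induction with
  | base => intro _; simp
  | succ b hab ih =>
    intro hb
    have h := (hδ (x (p + a)) (x (p + b)) (x (p + (b + 1))) (hx _ _ (by omega) (by omega))
      (hx _ _ (by omega) (by omega)) (hxN _ (by omega))).2
    rw [h, ih (by omega)]
    have h' := hup (b - 1) (by omega)
    rw [show p + (b - 1) + 1 = p + b by omega, show p + (b - 1) + 2 = p + (b + 1) by omega] at h'
    simpa using h'.le

theorem delta_eq_of_decreasing
    (hδ : ∀ a b c, a < b → b < c → c < 2 ^ N → δ a b ≠ δ b c ∧ δ a c = max (δ a b) (δ b c))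
    (hx : ∀ i j, i < j → j < M → x i < x j) (hxN : ∀ i < M, x i < 2 ^ N) {p n : ℕ}
    (hp : p + n < M) (hdown : ∀ i, i + 1 < n → δ (x (p + i + 1)) (x (p + i + 2)) <
      δ (x (p + i)) (x (p + i + 1))) :
    ∀ a b, a < b → b < n + 1 →
      δ (x (p + a)) (x (p + b)) = δ (x (p + a)) (x (p + a + 1)) := by
  have hanti : ∀ a b, a ≤ b → b < n →
      δ (x (p + b)) (x (p + b + 1)) ≤ δ (x (p + a)) (x (p + a + 1)) := by
    intro a b hab
    induction b, hab using Nat.le_induction with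
    | base => intro _; exact le_rfl
    | succ b hab ih => exact fun hb => (hdown b hb).le.trans (ih (by omega))
  intro a b hab
  induction b, hab using Nat.le_induction with
  | base => intro _; rfl
  | succ b hab ih =>
    intro hb
    have h := (hδ (x (p + a)) (x (p + b)) (x (p + (b + 1))) (hx _ _ (by omega) (by omega))
      (hx _ _ (by omega) (by omega)) (hxN _ (by omega))).2
    rw [h, ih (by omega)]
    exact max_eq_left (hanti a b (by omega) (by omega))

/-- The color reads only the first `k` differences, so the default values of `enum` beyond the set
are harmless and any `D` agreeing on these indices will do. -/
theorem stepUpColoring_image {φ : Finset ℕ → Bool} {k : ℕ} {y D : ℕ → ℕ}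
    (hy : ∀ i j, i < j → j < k + 1 → y i < y j) (hD : ∀ j < k, δ (y j) (y (j + 1)) = D j) :
    stepUpColoring δ φ k ((Finset.range (k + 1)).image y) = stepColor φ k D := by
  have h : ∀ j < k, δ (((Finset.range (k + 1)).image y).enum j)
      (((Finset.range (k + 1)).image y).enum (j + 1)) = D j := by
    intro j hj
    rw [Finset.enum_image hy (by omega), Finset.enum_image hy (by omega), hD j hj]
  rw [stepUpColoring]
  by_cases hm : ∀ i, i + 1 < k → goesUp D i = goesUp D 0
  · rw [stepColor_of_monotone (D := D) _ hm, stepColor_of_monotone (goesUp D 0)]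
    · congr 1
      exact Finset.image_congr fun j hj => h j (by simpa using hj)
    · intro i hi
      rw [goesUp_congr h hi, hm i hi]
  · push Not at hm
    classical
    have hm' := Nat.find_spec hm
    have hlt : ∀ i < Nat.find hm, goesUp D i = goesUp D 0 := by
      intro i hi
      have := Nat.find_min hm hi
      by_contra hne
      exact this ⟨by omega, hne⟩
    have h0 := goesUp_congr h (i := 0) (by omega)
    rw [stepColor_of_extremum hm'.1 hlt hm'.2, stepColor_of_extremum hm'.1, h0]
    · intro i hi
      rw [goesUp_congr h (by omega), h0, hlt i hi]
    · rw [goesUp_congr h hm'.1, h0]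
      exact hm'.2

/-- `Forces` supplies a monotone run of `n` consecutive differences, and these form the required
set. Any `k` of them are the exact difference sequence of some `k + 1` vertices of the run, whose
color is then the value of `φ`. -/
theorem exists_mono_set_of_stepUp {φ : Finset ℕ → Bool} {k n : ℕ} {γ : Bool} (hk : 1 ≤ k)
    (hδN : ∀ a b, a < b → b < 2 ^ N → δ a b < N)
    (hδ : ∀ a b c, a < b → b < c → c < 2 ^ N → δ a b ≠ δ b c ∧ δ a c = max (δ a b) (δ b c))
    (hF : Forces k M n)
    (h : ∃ A ⊆ Finset.range (2 ^ N), A.card = M ∧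
      ∀ e ⊆ A, e.card = k + 1 → stepUpColoring δ φ k e = γ) :
    ∃ A ⊆ Finset.range N, A.card = n ∧ ∀ e ⊆ A, e.card = k → φ e = γ := by
  obtain ⟨A, hAN, rfl, hA⟩ := h
  obtain ⟨x, hxA, hx⟩ : ∃ x : ℕ → ℕ, (∀ i < A.card, x i ∈ A) ∧
      ∀ i j, i < j → j < A.card → x i < x j :=
    ⟨A.enum, fun i hi => Finset.enum_mem hi, fun i j hij hj => Finset.enum_lt_enum hij hj⟩
  have hxN : ∀ i < A.card, x i < 2 ^ N := fun i hi => Finset.mem_range.1 (hAN (hxA i hi))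
  set D : ℕ → ℕ := fun i => δ (x i) (x (i + 1)) with hD
  have hcol : ∀ y E : ℕ → ℕ, (∀ i < k + 1, y i ∈ A) → (∀ i j, i < j → j < k + 1 → y i < y j) →
      (∀ j < k, δ (y j) (y (j + 1)) = E j) → stepColor φ k E = γ := by
    intro y E hyA hy hE
    rw [← stepUpColoring_image hy hE]
    refine hA _ ?_ (card_image_range_of_lt hy)
    intro z hz
    obtain ⟨i, hi, rfl⟩ := Finset.mem_image.1 hz
    exact hyA i (Finset.mem_range.1 hi)
  obtain ⟨p, hp, hu⟩ := hF γ (goesUp D) (by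
    intro t j ht hj h₁ h₂
    have hc := hcol (fun i => x (t + i)) (fun i => D (t + i)) (fun i hi => hxA _ (by omega))
      (fun i j hij hj => hx _ _ (by omega) (by omega)) (fun j hj => rfl)
    have hg : ∀ i, goesUp (fun i => D (t + i)) i = goesUp D (t + i) := fun i => rfl
    rw [stepColor_of_extremum hj] at hc
    · simpa [hg] using hc
    · intro i hi
      rw [hg, hg]
      exact h₁ i hi
    · rw [hg, hg]
      exact h₂)
  have hne : ∀ i, i + 1 < n → D (p + i) ≠ D (p + i + 1) := fun i hi =>
    (hδ _ _ _ (hx _ _ (by omega) (by omega)) (hx _ _ (by omega) (by omega))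
      (hxN _ (by omega))).1
  have hinc : goesUp D p = true → ∀ i, i + 1 < n → D (p + i) < D (p + i + 1) := by
    intro hb i hi
    have := hu i hi
    rw [hb] at this
    exact of_decide_eq_true this
  have hdec : goesUp D p = false → ∀ i, i + 1 < n → D (p + i + 1) < D (p + i) := by
    intro hb i hi
    have := hu i hi
    rw [hb] at this
    exact lt_of_le_of_ne (not_lt.1 (of_decide_eq_false this)) (hne i hi).symm
  have hincl : goesUp D p = true → ∀ i j, i < j → j < n → D (p + i) < D (p + j) := by
    intro hb i j hij
    induction j, hij using Nat.le_induction with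
    | base => exact hinc hb i
    | succ j hij ih => exact fun hj => (ih (by omega)).trans (hinc hb j hj)
  have hdecl : goesUp D p = false → ∀ i j, i < j → j < n → D (p + j) < D (p + i) := by
    intro hb i j hij
    induction j, hij using Nat.le_induction with
    | base => exact hdec hb i
    | succ j hij ih => exact fun hj => (hdec hb j hj).trans (ih (by omega))
  have hinj : ∀ i j, i < j → j < n → D (p + i) ≠ D (p + j) := by
    intro i j hij hj
    cases hb : goesUp D p with
    | true => exact (hincl hb i j hij hj).ne
    | false => exact (hdecl hb i j hij hj).ne'
  have hinj' : Set.InjOn (fun i => D (p + i)) (Finset.range n : Set ℕ) := by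
    intro i hi j hj hij
    simp only [Finset.coe_range, Set.mem_Iio] at hi hj
    rcases lt_trichotomy i j with h | h | h
    · exact absurd hij (hinj i j h hj)
    · exact h
    · exact absurd hij.symm (hinj j i h hi)
  refine ⟨(Finset.range n).image fun i => D (p + i), ?_, ?_, ?_⟩
  · intro z hz
    obtain ⟨i, hi, rfl⟩ := Finset.mem_image.1 hz
    have := Finset.mem_range.1 hi
    exact Finset.mem_range.2 (hδN _ _ (hx _ _ (by omega) (by omega)) (hxN _ (by omega)))
  · rw [Finset.card_image_of_injOn hinj', Finset.card_range]
  · intro e he hc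
    obtain ⟨I, hI, rfl⟩ := Finset.subset_image_iff.1 he
    rw [Finset.card_image_of_injOn (hinj'.mono hI)] at hc
    have hIm : ∀ j < k, I.enum j < n := fun j hj => by
      simpa using hI (Finset.enum_mem (hj.trans_eq hc.symm))
    have hIl : ∀ i j, i < j → j < k → I.enum i < I.enum j := fun i j hij hj =>
      Finset.enum_lt_enum hij (hj.trans_eq hc.symm)
    have himg : I.image (fun i => D (p + i)) =
        (Finset.range k).image fun j => D (p + I.enum j) := by
      conv_lhs => rw [← Finset.image_enum I, Finset.image_image, hc]
      rfl
    rw [himg]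
    cases hb : goesUp D p with
    | true =>
      -- Along an increasing run a difference is determined by its right endpoint, so the vertices
      -- are the right ends of the chosen differences, preceded by one starting vertex.
      have hc' := hcol (fun j => x (p + if j = 0 then I.enum 0 else I.enum (j - 1) + 1))
        (fun j => D (p + I.enum j)) ?_ ?_ ?_
      · rwa [stepColor_of_monotone true] at hc'
        exact fun i hi => decide_eq_true (hincl hb _ _ (hIl i (i + 1) (by omega) hi) (hIm _ hi))
      · intro j hj
        have h0 := hIm 0 (by omega)
        have hj' := hIm (j - 1) (by omega)
        refine hxA _ ?_
        split_ifs <;> omega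
      · intro i j hij hj
        have hj' := hIm (j - 1) (by omega)
        have hlt : (if i = 0 then I.enum 0 else I.enum (i - 1) + 1) <
            (if j = 0 then I.enum 0 else I.enum (j - 1) + 1) := by
          rw [if_neg (by omega : j ≠ 0)]
          split_ifs with hi
          · rcases Nat.eq_zero_or_pos (j - 1) with h | h
            · rw [h]; omega
            · have := hIl 0 (j - 1) h (by omega)
              omega
          · have := hIl (i - 1) (j - 1) (by omega) (by omega)
            omega
        refine hx _ _ (by omega) ?_
        rw [if_neg (by omega : j ≠ 0)]
        omega
      · intro j hj
        have h0 := hIm j hj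
        rw [if_neg (by omega : j + 1 ≠ 0), Nat.add_sub_cancel,
          delta_eq_of_increasing hδ hx hxN hp (hinc hb) _ _ _ (by omega)]
        · rfl
        · split_ifs with hj0
          · rw [hj0]; omega
          · have := hIl (j - 1) j (by omega) hj
            omega
    | false =>
      -- Along a decreasing run the left endpoint decides, so the left ends are taken, followed by
      -- one final vertex.
      have hc' := hcol (fun j => x (p + if j < k then I.enum j else I.enum (k - 1) + 1))
        (fun j => D (p + I.enum j)) ?_ ?_ ?_
      · rwa [stepColor_of_monotone false] at hc'
        exact fun i hi => decide_eq_false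
          (hdecl hb _ _ (hIl i (i + 1) (by omega) hi) (hIm _ hi)).le.not_gt
      · intro j hj
        have h0 := hIm (k - 1) (by omega)
        refine hxA _ ?_
        split_ifs with h
        · have := hIm j h
          omega
        · omega
      · intro i j hij hj
        have hk' := hIm (k - 1) (by omega)
        rw [if_pos (by omega : i < k)]
        split_ifs with h
        · have := hIl i j hij h
          have := hIm j h
          exact hx _ _ (by omega) (by omega)
        · refine hx _ _ ?_ (by omega)
          rcases eq_or_lt_of_le (by omega : i ≤ k - 1) with h | h
          · rw [h]; omega
          · have := hIl i (k - 1) h (by omega)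
            omega
      · intro j hj
        have h0 := hIm j hj
        have hk' := hIm (k - 1) (by omega)
        rw [if_pos hj, delta_eq_of_decreasing hδ hx hxN hp (hdec hb) _ _ _ _]
        · split_ifs with h
          · exact hIl _ _ (by omega) h
          · rw [show k - 1 = j by omega]; omega
        · split_ifs with h
          · have := hIm _ h
            omega
          · omega

end StepUp

theorem not_ramseyArrow_two_pow {N k s n s' n' : ℕ} (hk : 1 ≤ k) (hs : Forces k s' s)
    (hn : Forces k n' n) (h : ¬ RamseyArrow N k s n) : ¬ RamseyArrow (2 ^ N) (k + 1) s' n' := by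
  obtain ⟨δ, hδN, hδ⟩ := exists_delta N
  intro h'
  refine h ((ramseyArrow_iff_nat _ _ _ _).2 fun φ => ?_)
  exact ((ramseyArrow_iff_nat _ _ _ _).1 h' (stepUpColoring δ φ k)).imp
    (exists_mono_set_of_stepUp hk hδN hδ hs) (exists_mono_set_of_stepUp hk hδN hδ hn)

/-! ### Up-down sequences with monochromatic windows. -/

/-- A window of length 2 can change only at position 1, so `γ` fixes the direction of every change.
Hence there is at most one change among `2 * n - 3` terms, and one side of it contains `n - 1` equal
terms. -/
theorem forces_three {n : ℕ} (hn : 2 ≤ n) : Forces 3 (2 * n - 1) n := by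
  intro γ u hu
  have hγ : ∀ t, t + 3 < 2 * n - 1 → u (t + 1) ≠ u t → u t = !γ := by
    intro t ht hne
    have := hu t 1 ht (by norm_num) (fun i hi => by simp [Nat.lt_one_iff.1 hi]) hne
    cases h : u t <;> simp [h] at this <;> simp [← this]
  have hc : ∀ a, (∀ i, i < a → u (i + 1) = u i) → ∀ i, i ≤ a → u i = u 0 := by
    intro a ha i
    induction i with
    | zero => exact fun _ => rfl
    | succ i ih => exact fun hi => (ha i (by omega)).trans (ih (by omega))
  by_cases h : ∀ i, i < n - 2 → u (i + 1) = u i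
  · refine ⟨0, by omega, fun i hi => ?_⟩
    rw [Nat.zero_add]
    exact hc _ h i (by omega)
  · push Not at h
    obtain ⟨a, ha, hne⟩ := h
    have h₁ := hγ a (by omega) hne
    have h₂ : u (a + 1) = γ := by
      cases γ <;> cases h' : u (a + 1) <;> simp_all
    have h₃ : ∀ j, a + 1 + j + 2 < 2 * n - 1 → u (a + 1 + j) = γ := by
      intro j
      induction j with
      | zero => exact fun _ => h₂
      | succ j ih =>
        intro hj
        have h₄ := ih (by omega)
        by_contra h₅
        have := hγ (a + 1 + j) (by omega) (by rw [h₄]; exact h₅)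
        rw [h₄] at this
        cases γ <;> simp at this
    refine ⟨n - 2, by omega, fun i hi => ?_⟩
    have e₁ := h₃ (n - 2 - (a + 1)) (by omega)
    have e₂ := h₃ (n - 2 - (a + 1) + i) (by omega)
    rw [show a + 1 + (n - 2 - (a + 1)) = n - 2 by omega] at e₁
    rw [show a + 1 + (n - 2 - (a + 1) + i) = n - 2 + i by omega] at e₂
    rw [e₁, e₂]

/-- Two windows with starts one apart that first see the same change from the same value give it
opposite parities, hence opposite colors. Only the first term and the last one can escape such a
pair of windows. -/
theorem eq_of_windows {k M : ℕ} (hk : 4 ≤ k) (hM : k + 3 ≤ M) {γ : Bool} {u : ℕ → Bool}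
    (hu : ∀ t j, t + k < M → j + 1 < k → (∀ i < j, u (t + i) = u t) → u (t + j) ≠ u t →
      decide (Even j ↔ u t = true) = γ) :
    ∀ i, 1 ≤ i → i + 3 < M → u i = u 1 := by
  have h₁ : ∀ t, t + k < M → u (t + 1) ≠ u t → γ = !u t := by
    intro t ht hne
    have := hu t 1 ht (by omega) (fun i hi => by simp [Nat.lt_one_iff.1 hi]) hne
    rw [← this]
    cases u t <;> simp
  have h₂ : ∀ t, t + k < M → u (t + 1) = u t → u (t + 2) ≠ u t → γ = u t := by
    intro t ht he hne
    have := hu t 2 ht (by omega) (fun i hi => by interval_cases i <;> simp [he]) hne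
    rw [← this]
    cases u t <;> simp
  have h₃ : ∀ i, 1 ≤ i → i + k < M → u (i + 1) = u i := by
    intro i hi hik
    by_contra hne
    have e₁ := h₁ i hik hne
    obtain ⟨t, rfl⟩ : ∃ t, i = t + 1 := ⟨i - 1, by omega⟩
    by_cases h : u (t + 1) = u t
    · have e₂ := h₂ t (by omega) h (by rwa [← h])
      rw [h, ← e₂] at e₁
      cases γ <;> simp at e₁
    · have e₂ := h₁ t (by omega) h
      rw [e₂] at e₁
      exact h (by simpa using e₁.symm)
  intro i
  induction i using Nat.strong_induction_on with
  | _ i ih =>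
    intro hi hiM
    rcases eq_or_lt_of_le hi with rfl | hi
    · rfl
    obtain ⟨m, rfl⟩ : ∃ m, i = m + 1 := ⟨i - 1, by omega⟩
    by_cases hm : m + k < M
    · rw [h₃ m (by omega) hm, ih m (by omega) (by omega) (by omega)]
    · by_contra hne
      -- Near the end no window starts at the change itself; the last two windows, starting at `M -
      -- 1 - k` and `M - 2 - k`, both contain it and disagree.
      have hw : ∀ t, 1 ≤ t → t + k < M → m + 2 - t < k →
          decide (Even (m + 1 - t) ↔ u 1 = true) = γ := by
        intro t ht htk htm
        have ht1 : u t = u 1 := ih t (by omega) ht (by omega)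
        rw [← ht1]
        refine hu t (m + 1 - t) htk (by omega) (fun j hj => ?_) ?_
        · rw [ht1]
          exact ih _ (by omega) (by omega) (by omega)
        · rwa [ht1, show t + (m + 1 - t) = m + 1 by omega]
      have e₁ := hw (M - 1 - k) (by omega) (by omega) (by omega)
      have e₂ := hw (M - 2 - k) (by omega) (by omega) (by omega)
      rw [← e₂, show m + 1 - (M - 2 - k) = m + 1 - (M - 1 - k) + 1 by omega,
        decide_eq_decide, Nat.even_add_one] at e₁
      tauto

theorem forces_add_three {k n : ℕ} (hk : 4 ≤ k) (hn : k ≤ n) : Forces k (n + 3) n := by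
  intro γ u hu
  refine ⟨1, by omega, fun i hi => ?_⟩
  exact eq_of_windows hk (by omega) hu _ (by omega) (by omega)

/-- If both end terms differ from the constant middle, the first window changes at position 1 and
the last one at position `k - 2`. For odd `k` both positions are odd while the starting values
differ, so the colors differ. -/
theorem forces_add_two {k n : ℕ} (hk : 4 ≤ k) (hodd : Odd k) (hn : k + 1 ≤ n) :
    Forces k (n + 2) n := by
  intro γ u hu
  have hc := eq_of_windows hk (by omega) hu
  by_cases h₀ : u 0 = u 1
  · refine ⟨0, by omega, fun i hi => ?_⟩
    rw [Nat.zero_add]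
    rcases Nat.eq_zero_or_pos i with rfl | hi'
    · rfl
    · rw [h₀, hc i hi' (by omega)]
  by_cases h₁ : u (n - 1) = u 1
  · refine ⟨1, by omega, fun i hi => ?_⟩
    by_cases hin : 1 + i = n - 1
    · rw [hin, h₁]
    · exact hc _ (by omega) (by omega)
  exfalso
  have e₀ := hu 0 1 (by omega) (by omega) (fun i hi => by simp [Nat.lt_one_iff.1 hi])
    (by simpa using Ne.symm h₀)
  have ht : u (n + 1 - k) = u 1 := hc _ (by omega) (by omega)
  have e₁ := hu (n + 1 - k) (k - 2) (by omega) (by omega)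
    (fun i hi => by rw [ht]; exact hc _ (by omega) (by omega))
    (by rwa [ht, show n + 1 - k + (k - 2) = n - 1 by omega])
  have hpar : ¬ Even (k - 2) := by
    rw [Nat.even_sub (by omega)]
    simpa using hodd
  rw [← e₁, ht, decide_eq_decide] at e₀
  simp only [Nat.not_even_one, hpar, false_iff] at e₀
  apply h₀
  cases h : u 0 <;> cases h' : u 1 <;> simp_all

/-! ### A triangle-free graph on the cube with small independence number. -/

/-- Two sets of binary vectors of length `d` at Hamming distance at least `s` satisfy
`|A| |B| 2 ^ s ≤ (9 / 2) ^ d`. -/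
theorem card_mul_card_le_of_hammingDist (d : ℕ) : ∀ (s : ℕ) (A B : Finset (Fin d → Bool)),
    (∀ a ∈ A, ∀ b ∈ B, s ≤ hammingDist a b) →
    (A.card : ℝ) * B.card * 2 ^ s ≤ (9 / 2) ^ d := by
  induction d with
  | zero =>
    intro s A B h
    have hA : A.card ≤ 1 := (Finset.card_le_univ A).trans (by simp)
    have hB : B.card ≤ 1 := (Finset.card_le_univ B).trans (by simp)
    rcases A.eq_empty_or_nonempty with rfl | ⟨a, ha⟩
    · simp
    rcases B.eq_empty_or_nonempty with rfl | ⟨b, hb⟩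
    · simp
    have hs : s = 0 := by
      have := h a ha b hb
      rw [Subsingleton.elim a b, hammingDist_self] at this
      omega
    subst hs
    have : A.card * B.card ≤ 1 := by nlinarith
    simpa using (by exact_mod_cast this : (A.card : ℝ) * B.card ≤ 1)
  | succ d ih =>
    intro s A B h
    let S : Finset (Fin (d + 1) → Bool) → Bool → Finset (Fin d → Bool) :=
      fun A c => Finset.univ.filter fun v => (Fin.cons c v : Fin (d + 1) → Bool) ∈ A
    have hcard : ∀ A, (A.card : ℝ) = (S A false).card + (S A true).card := by
      intro A
      have hc : ∀ c, (S A c).card = (A.filter fun v => v 0 = c).card := by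
        intro c
        refine Finset.card_bij (fun v _ => Fin.cons c v) ?_ ?_ ?_
        · intro v hv
          simpa [S] using hv
        · intro v _ w _ hvw
          exact Fin.cons_right_injective (α := fun _ => Bool) c hvw
        · intro v hv
          obtain ⟨hvA, hv0⟩ := Finset.mem_filter.1 hv
          have hv' : (Fin.cons c (Fin.tail v) : Fin (d + 1) → Bool) = v := by
            rw [← hv0]
            exact Fin.cons_self_tail v
          exact ⟨Fin.tail v, by simpa [S, hv'] using hvA, hv'⟩
      rw [hc, hc]
      have := Finset.card_filter_add_card_filter_not (s := A) (fun v => v 0 = false)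
      simp only [Bool.not_eq_false] at this
      exact_mod_cast this.symm
    have hdist : ∀ (c c' : Bool) (v w : Fin d → Bool),
        hammingDist (Fin.cons c v : Fin (d + 1) → Bool) (Fin.cons c' w) =
          (if c = c' then 0 else 1) + hammingDist v w := by
      intro c c' v w
      simp only [hammingDist, Finset.card_filter, Fin.sum_univ_succ, Fin.cons_zero, Fin.cons_succ]
      by_cases h : c = c' <;> simp [h]
    have hsame : ∀ c, ((S A c).card : ℝ) * (S B c).card * 2 ^ s ≤ (9 / 2) ^ d := by
      intro c
      refine ih s _ _ fun v hv w hw => ?_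
      have := h _ (Finset.mem_filter.1 hv).2 _ (Finset.mem_filter.1 hw).2
      simpa [hdist] using this
    have hdiff : ∀ c, ((S A c).card : ℝ) * (S B !c).card * 2 ^ s ≤ 2 * (9 / 2) ^ d := by
      intro c
      have h' := ih (s - 1) (S A c) (S B !c) fun v hv w hw => by
        have := h _ (Finset.mem_filter.1 hv).2 _ (Finset.mem_filter.1 hw).2
        rw [hdist, if_neg (by cases c <;> simp)] at this
        omega
      -- Stated as an inequality to cover the truncated `s - 1` at `s = 0`.
      have h2 : (2 : ℝ) ^ s ≤ 2 * 2 ^ (s - 1) := by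
        rw [← pow_succ']
        exact pow_le_pow_right₀ one_le_two (by omega)
      calc ((S A c).card : ℝ) * (S B !c).card * 2 ^ s
          ≤ (S A c).card * (S B !c).card * (2 * 2 ^ (s - 1)) := by gcongr
        _ = 2 * ((S A c).card * (S B !c).card * 2 ^ (s - 1)) := by ring
        _ ≤ _ := by gcongr
    have e₁ := hsame false
    have e₂ := hsame true
    have e₃ := hdiff false
    have e₄ := hdiff true
    rw [hcard A, hcard B, pow_succ]
    simp only [Bool.not_false, Bool.not_true] at e₃ e₄
    have hK : (0 : ℝ) < (9 / 2) ^ d := by positivity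
    generalize ((9 : ℝ) / 2) ^ d = K at *
    have hp : (0 : ℝ) < 2 ^ s := by positivity
    generalize (2 : ℝ) ^ s = p at *
    have p₁ : (0 : ℝ) ≤ (S A false).card := Nat.cast_nonneg _
    have p₂ : (0 : ℝ) ≤ (S A true).card := Nat.cast_nonneg _
    have p₃ : (0 : ℝ) ≤ (S B false).card := Nat.cast_nonneg _
    have p₄ : (0 : ℝ) ≤ (S B true).card := Nat.cast_nonneg _
    generalize ((S A false).card : ℝ) = a₀ at *
    generalize ((S A true).card : ℝ) = a₁ at *
    generalize ((S B false).card : ℝ) = b₀ at *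
    generalize ((S B true).card : ℝ) = b₁ at *
    have q₁ : 0 ≤ a₀ * b₀ * p := by positivity
    have q₂ : 0 ≤ a₁ * b₁ * p := by positivity
    have hprod : (a₀ * b₁ * p) * (a₁ * b₀ * p) ≤ K * K := by
      calc (a₀ * b₁ * p) * (a₁ * b₀ * p) = (a₀ * b₀ * p) * (a₁ * b₁ * p) := by ring
        _ ≤ K * K := mul_le_mul e₁ e₂ q₂ hK.le
    -- Two numbers at most 2K with product at most K² sum to at most 2K + K/2. With the two diagonal
    -- terms, each at most K, this gives the factor 9/2.
    have hz : a₀ * b₁ * p + a₁ * b₀ * p ≤ 5 / 2 * K := by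
      have := mul_nonneg (sub_nonneg.2 e₃) (sub_nonneg.2 e₄)
      by_contra hcon
      push Not at hcon
      nlinarith
    linarith

/-- There are triangle-free graphs on `8 ^ e` vertices without independent sets of more than
`7 ^ e` vertices. -/
theorem exists_triangleFree (e : ℕ) : ∃ R : (Fin (3 * e) → Bool) → (Fin (3 * e) → Bool) → Prop,
    (∀ a, ¬ R a a) ∧ (∀ a b, R a b → R b a) ∧ (∀ a b c, R a b → R a c → R b c → False) ∧
    ∀ A : Finset (Fin (3 * e) → Bool), (∀ a ∈ A, ∀ b ∈ A, ¬ R a b) → A.card ≤ 7 ^ e := by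
  refine ⟨fun a b => 2 * e < hammingDist a b, fun a => by simp,
    fun a b h => (hammingDist_comm a b).subst (motive := fun x => 2 * e < x) h, ?_, ?_⟩
  · intro a b c hab hac hbc
    have key : hammingDist a b + hammingDist a c + hammingDist b c ≤ 2 * (3 * e) := by
      simp only [hammingDist, Finset.card_filter]
      rw [← Finset.sum_add_distrib, ← Finset.sum_add_distrib]
      refine (Finset.sum_le_card_nsmul _ _ 2 fun i _ => ?_).trans_eq (by simp [mul_comm])
      cases a i <;> cases b i <;> cases c i <;> simp
    omega
  · intro A hA
    have hcompl : ∀ a b : Fin (3 * e) → Bool,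
        hammingDist a (fun i => !b i) + hammingDist a b = 3 * e := by
      intro a b
      simp only [hammingDist, Finset.card_filter]
      rw [← Finset.sum_add_distrib]
      refine (Finset.sum_congr rfl (g := fun _ => 1) fun i _ => ?_).trans (by simp)
      cases a i <;> cases b i <;> simp
    -- An independent set has distances at most `2 * e`, so it is at distance at least `e` from its
    -- set of antipodes. The bound 7 comes from (9/2)³ ≤ 2 · 7².
    have h := card_mul_card_le_of_hammingDist (3 * e) e A (A.image fun b i => !b i) (by
      intro a ha b hb
      obtain ⟨b', hb', rfl⟩ := Finset.mem_image.1 hb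
      have h₁ := hcompl a b'
      have h₂ : ¬ 2 * e < hammingDist a b' := hA a ha b' hb'
      omega)
    rw [Finset.card_image_of_injective _ (fun a b hab => by
      funext i
      simpa using congrFun hab i)] at h
    have h' : (A.card : ℝ) ^ 2 ≤ (7 ^ e) ^ 2 := by
      have h2 : (0 : ℝ) < 2 ^ e := by positivity
      rw [← mul_le_mul_iff_left₀ h2, sq]
      refine h.trans ?_
      rw [pow_mul, pow_right_comm (7 : ℝ) e 2, ← mul_pow]
      exact pow_le_pow_left₀ (by norm_num) (by norm_num) e
    exact_mod_cast abs_le_of_sq_le_sq' h' (by positivity) |>.2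

/-! ### Random colorings of pairs and the lower bound for r_3(4, m). -/

section RandomColoring

variable {V : Type*} [Fintype V] [DecidableEq V]

/-- Such a function is encoded by a list of `a` values covering the image of `U`, a choice from the
list at each point of `U`, and arbitrary values elsewhere. -/
theorem card_filter_image_card_le [Nonempty V] {N : ℕ} (U : Finset (Fin N)) (a : ℕ) :
    (Finset.univ.filter fun f : Fin N → V => (U.image f).card ≤ a).card ≤
      Fintype.card V ^ a * a ^ U.card * Fintype.card V ^ (N - U.card) := by
  let F : (Fin a → V) × (U → Fin a) × ((Uᶜ : Finset (Fin N)) → V) → Fin N → V := fun p i =>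
    if h : i ∈ U then p.1 (p.2.1 ⟨i, h⟩) else p.2.2 ⟨i, Finset.mem_compl.2 h⟩
  have hsub : (Finset.univ.filter fun f : Fin N → V => (U.image f).card ≤ a) ⊆
      Finset.univ.image F := by
    intro f hf
    have hf' : Fintype.card (U.image f) ≤ Fintype.card (Fin a) := by
      rw [Fintype.card_coe, Fintype.card_fin]
      exact (Finset.mem_filter.1 hf).2
    obtain ⟨g⟩ := Function.Embedding.nonempty_of_card_le hf'
    refine Finset.mem_image.2 ⟨⟨Function.extend g Subtype.val fun _ => Classical.arbitrary V,
      fun i => g ⟨f i, Finset.mem_image_of_mem f i.2⟩, fun i => f i⟩, Finset.mem_univ _, ?_⟩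
    funext i
    by_cases h : i ∈ U
    · simp only [F, dif_pos h]
      rw [g.injective.extend_apply]
    · simp only [F, dif_neg h]
  refine (Finset.card_le_card hsub).trans (Finset.card_image_le.trans_eq ?_)
  simp [mul_assoc]

/-- Union bound by counting: there are at most `N ^ (2 * t)` pairs `(L, U)`, and the rows of the `t`
elements of `L` fail independently. -/
theorem exists_coloring_of_lt [Nonempty V] {N a t : ℕ} (ht : t ≠ 0)
    (h : N ^ 2 * Fintype.card V ^ a * a ^ t < Fintype.card V ^ t) :
    ∃ χ : Fin N → Fin N → V, ∀ L U : Finset (Fin N), L.card = t → U.card = t →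
      ∃ u ∈ L, a < (U.image (χ u)).card := by
  by_contra! hcon
  set m := Fintype.card V with hm
  have hm0 : 0 < m := Fintype.card_pos
  let G : Finset (Fin N) → Finset (Fin N → V) := fun U =>
    Finset.univ.filter fun f => (U.image f).card ≤ a
  let B : Finset (Fin N) × Finset (Fin N) → Finset (Fin N → Fin N → V) := fun p =>
    Fintype.piFinset fun u => if u ∈ p.1 then G p.2 else Finset.univ
  let P := Finset.powersetCard t (Finset.univ : Finset (Fin N))
  have hcov : (Finset.univ : Finset (Fin N → Fin N → V)) ⊆ (P ×ˢ P).biUnion B := by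
    intro χ _
    obtain ⟨L, U, hL, hU, hχ⟩ := hcon χ
    refine Finset.mem_biUnion.2 ⟨(L, U), ?_, ?_⟩
    · simp [P, hL, hU]
    · rw [Fintype.mem_piFinset]
      intro u
      dsimp only
      split_ifs with hu
      · simpa [G] using hχ u hu
      · exact Finset.mem_univ _
  have hB : ∀ p ∈ P ×ˢ P, (B p).card ≤
      (m ^ a * a ^ t * m ^ (N - t)) ^ t * (m ^ N) ^ (N - t) := by
    rintro ⟨L, U⟩ hp
    simp only [P, Finset.mem_product, Finset.mem_powersetCard_univ] at hp
    have hG := card_filter_image_card_le (V := V) U a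
    rw [hp.2] at hG
    rw [Fintype.card_piFinset]
    rw [← Finset.prod_mul_prod_compl L]
    have e₁ : ∏ i ∈ L, (if i ∈ L then G U else Finset.univ).card = (G U).card ^ t := by
      rw [Finset.prod_congr rfl (g := fun _ => (G U).card) (fun i hi => by rw [if_pos hi]),
        Finset.prod_const, hp.1]
    have e₂ : ∏ i ∈ Lᶜ, (if i ∈ L then G U else Finset.univ).card = (m ^ N) ^ (N - t) := by
      rw [Finset.prod_congr rfl (g := fun _ => m ^ N) (fun i hi => by
        rw [if_neg (Finset.mem_compl.1 hi)]; simp [hm]),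
        Finset.prod_const, Finset.card_compl, hp.1, Fintype.card_fin]
    rw [e₁, e₂]
    gcongr
  have hcard := (Finset.card_le_card hcov).trans
    (Finset.card_biUnion_le.trans (Finset.sum_le_card_nsmul _ _ _ hB))
  have hP : P.card = N.choose t := by simp [P]
  rw [Finset.card_product, hP, smul_eq_mul, Finset.card_univ, Fintype.card_pi_const,
    Fintype.card_pi_const, ← hm] at hcard
  rcases lt_or_ge N t with hNt | hNt
  · rw [Nat.choose_eq_zero_of_lt hNt] at hcard
    simp only [zero_mul, Nat.le_zero] at hcard
    exact absurd hcard (by positivity)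
  · have hch : N.choose t ≤ N ^ t := Nat.choose_le_pow N t
    have : (m ^ N) ^ N < (m ^ N) ^ N := by
      calc (m ^ N) ^ N
          ≤ N ^ t * N ^ t * ((m ^ a * a ^ t * m ^ (N - t)) ^ t * (m ^ N) ^ (N - t)) :=
            hcard.trans (by gcongr)
        _ = (N ^ 2 * m ^ a * a ^ t) ^ t * (m ^ (N - t)) ^ t * (m ^ N) ^ (N - t) := by ring
        _ < (m ^ t) ^ t * (m ^ (N - t)) ^ t * (m ^ N) ^ (N - t) := by
            gcongr
        _ = (m ^ N) ^ N := by
            rw [← mul_pow, ← pow_add, Nat.add_sub_cancel' hNt, ← pow_add,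
              Nat.add_sub_cancel' hNt]
    exact lt_irrefl _ this

/-- In a blue set of size `2 * t`, some `u` in the lower half sees more than `a` colors on the upper
half; these are pairwise nonadjacent, against `hind`. -/
theorem not_ramseyArrow_three_of_lt [Nonempty V] {N a t : ℕ} {R : V → V → Prop} (ht : t ≠ 0)
    (hirr : ∀ a, ¬ R a a) (hsymm : ∀ a b, R a b → R b a)
    (htri : ∀ a b c, R a b → R a c → R b c → False)
    (hind : ∀ A : Finset V, (∀ a ∈ A, ∀ b ∈ A, ¬ R a b) → A.card ≤ a)
    (h : N ^ 2 * Fintype.card V ^ a * a ^ t < Fintype.card V ^ t) :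
    ¬ RamseyArrow N 3 4 (2 * t) := by
  classical
  obtain ⟨χ, hχ⟩ := exists_coloring_of_lt ht h
  intro hA
  rcases hA fun e => decide (∀ u ∈ e, ∀ v ∈ e, ∀ w ∈ e, u < v → v < w → R (χ u v) (χ u w)) with
    ⟨A, hAc, hA⟩ | ⟨A, hAc, hA⟩
  · set f := A.orderEmbOfFin hAc
    have hf : ∀ i, f i ∈ A := Finset.orderEmbOfFin_mem A hAc
    have key : ∀ i j k : Fin 4, i < j → j < k → R (χ (f i) (f j)) (χ (f i) (f k)) := by
      intro i j k hij hjk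
      have h₁ : f i < f j := f.strictMono hij
      have h₂ : f j < f k := f.strictMono hjk
      have := hA {f i, f j, f k} (by simp [Finset.insert_subset_iff, hf])
        (Finset.card_eq_three.2 ⟨_, _, _, h₁.ne, (h₁.trans h₂).ne, h₂.ne, rfl⟩)
      exact of_decide_eq_true this _ (by simp) _ (by simp) _ (by simp) h₁ h₂
    exact htri _ _ _ (key 0 1 2 (by decide) (by decide)) (key 0 1 3 (by decide) (by decide))
      (key 0 2 3 (by decide) (by decide))
  · have key : ∀ u ∈ A, ∀ v ∈ A, ∀ w ∈ A, u < v → v < w → ¬ R (χ u v) (χ u w) := by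
      intro u hu v hv w hw huv hvw
      have := hA {u, v, w} (by simp [Finset.insert_subset_iff, hu, hv, hw])
        (Finset.card_eq_three.2 ⟨_, _, _, huv.ne, (huv.trans hvw).ne, hvw.ne, rfl⟩)
      have := of_decide_eq_false this
      push Not at this
      obtain ⟨u', hu', v', hv', w', hw', h₁, h₂, h₃⟩ := this
      simp only [Finset.mem_insert, Finset.mem_singleton] at hu' hv' hw'
      have e : u' = u ∧ v' = v ∧ w' = w := by omega
      rwa [e.1, e.2.1, e.2.2] at h₃
    set f := A.orderEmbOfFin hAc
    have hf : ∀ i, f i ∈ A := Finset.orderEmbOfFin_mem A hAc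
    have hinj : ∀ g : Fin t → Fin (2 * t), Function.Injective g →
        ((Finset.univ : Finset (Fin t)).image fun i => f (g i)).card = t := by
      intro g hg
      exact (Finset.card_image_of_injective _ (f.injective.comp hg)).trans (by simp)
    obtain ⟨u, hu, hua⟩ := hχ
      (Finset.univ.image fun i : Fin t => f ⟨i, by omega⟩)
      (Finset.univ.image fun i : Fin t => f ⟨t + i, by omega⟩)
      (hinj _ fun i j hij => by simpa [Fin.ext_iff] using hij)
      (hinj _ fun i j hij => by simpa [Fin.ext_iff] using hij)
    obtain ⟨i, -, rfl⟩ := Finset.mem_image.1 hu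
    refine hua.not_ge (hind _ ?_)
    intro a ha b hb
    rw [Finset.image_image] at ha hb
    obtain ⟨j, -, rfl⟩ := Finset.mem_image.1 ha
    obtain ⟨k, -, rfl⟩ := Finset.mem_image.1 hb
    have hlt : ∀ j : Fin t, f ⟨i, by omega⟩ < f ⟨t + j, by omega⟩ := fun j =>
      f.strictMono (Fin.mk_lt_mk.2 (by omega))
    have hlt' : ∀ j k : Fin t, j < k →
        f (⟨t + j, by omega⟩ : Fin (2 * t)) < f ⟨t + k, by omega⟩ := fun j k hjk =>
      f.strictMono (Fin.mk_lt_mk.2 (by omega))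
    dsimp only [Function.comp]
    rcases lt_trichotomy j k with hjk | rfl | hjk
    · exact key _ (hf _) _ (hf _) _ (hf _) (hlt j) (hlt' j k hjk)
    · exact hirr _
    · exact fun hR => key _ (hf _) _ (hf _) _ (hf _) (hlt k) (hlt' k j hjk) (hsymm _ _ hR)

end RandomColoring

/-- Everything is measured in powers of 8/7, using 4 ≤ (8/7)^12 and 8 ≤ (8/7)^16; each hypothesis
spends half of the exponent `e * t`. -/
theorem two_pow_sq_mul_lt {e t q : ℕ} (ht : 32 * 7 ^ e ≤ t) (hq : 24 * q < e * t) :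
    (2 ^ q) ^ 2 * (8 ^ e) ^ (7 ^ e) * (7 ^ e) ^ t < (8 ^ e) ^ t := by
  have h₁ : ((2 : ℝ) ^ q) ^ 2 ≤ (8 / 7) ^ (12 * q) := by
    rw [← pow_mul, mul_comm q 2, pow_mul, pow_mul]
    exact pow_le_pow_left₀ (by norm_num) (by norm_num) q
  have h₂ : ((8 : ℝ) ^ e) ^ (7 ^ e) ≤ (8 / 7) ^ (16 * (e * 7 ^ e)) := by
    rw [← pow_mul, pow_mul (8 / 7 : ℝ)]
    exact pow_le_pow_left₀ (by norm_num) (by norm_num) _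
  have h₃ : 12 * q + 16 * (e * 7 ^ e) < e * t := by
    have := Nat.mul_le_mul_left e ht
    nlinarith
  have h : ((2 : ℝ) ^ q) ^ 2 * (8 ^ e) ^ (7 ^ e) * (7 ^ e) ^ t < (8 ^ e) ^ t := by
    calc ((2 : ℝ) ^ q) ^ 2 * (8 ^ e) ^ (7 ^ e) * (7 ^ e) ^ t
        ≤ (8 / 7) ^ (12 * q) * (8 / 7) ^ (16 * (e * 7 ^ e)) * (7 ^ e) ^ t := by gcongr
      _ = (8 / 7) ^ (12 * q + 16 * (e * 7 ^ e)) * (7 ^ e) ^ t := by rw [pow_add]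
      _ < (8 / 7) ^ (e * t) * (7 ^ e) ^ t := by
          gcongr
          norm_num
      _ = (8 ^ e) ^ t := by
          rw [← pow_mul, ← pow_mul, ← mul_pow]
          norm_num
  exact_mod_cast h

theorem not_ramseyArrow_three_four {m e q : ℕ} (ht : 32 * 7 ^ e ≤ m / 2)
    (hq : 24 * q < e * (m / 2)) : ¬ RamseyArrow (2 ^ q) 3 4 m := by
  obtain ⟨R, h₁, h₂, h₃, h₄⟩ := exists_triangleFree e
  have hcard : Fintype.card (Fin (3 * e) → Bool) = 8 ^ e := by
    simp [pow_mul]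
  intro h
  have ht0 : m / 2 ≠ 0 := by
    have := Nat.pow_pos (n := e) (show 0 < 7 by norm_num)
    omega
  refine not_ramseyArrow_three_of_lt ht0 h₁ h₂ h₃ h₄ (N := 2 ^ q) (t := m / 2) ?_
    (h.mono le_rfl le_rfl (by omega))
  rw [hcard]
  exact two_pow_sq_mul_lt ht hq

theorem exists_not_ramseyArrow_three_four : ∃ c : ℝ, 0 < c ∧ ∀ m : ℕ, 5 ≤ m →
    ∃ N : ℕ, (2 : ℝ) ^ (c * m * Real.log m) ≤ N ∧ ¬ RamseyArrow N 3 4 m := by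
  -- The constant is 1/450²: below 450 the claimed bound is at most 2, and from 450 on `m / 2 / 32 ≥
  -- 7`, so that `e ≥ 1`.
  refine ⟨1 / 202500, by norm_num, fun m hm => ?_⟩
  have hm0 : (0 : ℝ) < m := by positivity
  rcases lt_or_ge m 450 with hlt | hge
  · refine ⟨2, ?_, ?_⟩
    · have h₁ : Real.log m ≤ 450 := by
        have h := Real.log_le_self hm0.le
        have : (m : ℝ) < 450 := by exact_mod_cast hlt
        linarith
      have h₂ : (m : ℝ) ≤ 450 := by exact_mod_cast hlt.le
      have h₃ : (m : ℝ) * Real.log m ≤ 450 * 450 :=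
        mul_le_mul h₂ h₁ (Real.log_nonneg (by exact_mod_cast (by omega : 1 ≤ m))) (by norm_num)
      calc (2 : ℝ) ^ (1 / 202500 * (m : ℝ) * Real.log m) ≤ 2 ^ (1 : ℝ) :=
            Real.rpow_le_rpow_of_exponent_le one_le_two (by nlinarith)
        _ = _ := by norm_num
    · intro h
      rcases h fun _ => true with ⟨A, hA, -⟩ | ⟨A, hA, -⟩ <;>
      · have := A.card_le_univ
        rw [Fintype.card_fin] at this
        omega
  · obtain ⟨t, ht⟩ : ∃ t, t = m / 2 := ⟨_, rfl⟩
    obtain ⟨e, he⟩ : ∃ e, e = Nat.log 7 (t / 32) := ⟨_, rfl⟩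
    have he1 : 1 ≤ e := by
      rw [he]
      exact Nat.log_pos (by norm_num) (by omega)
    have h₁ : 7 ^ e ≤ t / 32 := by
      rw [he]
      exact Nat.pow_log_le_self 7 (by omega)
    have h₂ : t / 32 < 7 ^ (e + 1) := by
      rw [he]
      exact Nat.lt_pow_succ_log_self (by norm_num) _
    have het : 224 ≤ e * t := le_trans (by omega) (Nat.le_mul_of_pos_left t he1)
    refine ⟨2 ^ ((e * t - 1) / 24), ?_,
      not_ramseyArrow_three_four (e := e) (by omega) (by rw [← ht]; omega)⟩
    have hlog : Real.log m ≤ 10 * e := by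
      have h₃ : m ≤ 7 ^ (e + 4) := by
        have : 7 ^ (e + 4) = 343 * 7 ^ (e + 1) := by ring
        omega
      calc Real.log m ≤ Real.log (7 ^ (e + 4)) :=
            Real.log_le_log hm0 (by exact_mod_cast h₃)
        _ = (e + 4) * Real.log 7 := by rw [Real.log_pow]; push_cast; ring
        _ ≤ (e + 4) * 2 := by
            gcongr
            rw [Real.log_le_iff_le_exp (by norm_num)]
            have h := Real.exp_one_gt_d9
            have h' : Real.exp 2 = Real.exp 1 * Real.exp 1 := by rw [← Real.exp_add]; norm_num
            rw [h']
            nlinarith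
        _ ≤ 10 * e := by
            have : (1 : ℝ) ≤ e := by exact_mod_cast he1
            linarith
    have hq : ((e : ℝ) * t) / 48 ≤ ((e * t - 1) / 24 : ℕ) := by
      have : e * t ≤ 48 * ((e * t - 1) / 24) := by omega
      have : (e : ℝ) * t ≤ 48 * ((e * t - 1) / 24 : ℕ) := by exact_mod_cast this
      linarith
    have ht3 : (m : ℝ) ≤ 3 * t := by exact_mod_cast (by omega : m ≤ 3 * t)
    have hml : (m : ℝ) * Real.log m ≤ 3 * t * (10 * e) :=
      mul_le_mul ht3 hlog (Real.log_nonneg (by exact_mod_cast (by omega : 1 ≤ m)))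
        (by positivity)
    push_cast
    rw [← Real.rpow_natCast]
    refine Real.rpow_le_rpow_of_exponent_le one_le_two (le_trans ?_ hq)
    have : (0 : ℝ) ≤ e * t := by positivity
    nlinarith

/-! ### Estimates for the tower function. -/

theorem tower_mono {x y : ℝ} (h : x ≤ y) (i : ℕ) : tower i x ≤ tower i y := by
  induction i with
  | zero => exact h
  | succ i ih =>
    cases i with
    | zero => exact h
    | succ i => exact Real.rpow_le_rpow_of_exponent_le one_le_two ih

theorem tower_nonneg {x : ℝ} (h : 0 ≤ x) (i : ℕ) : 0 ≤ tower i x := by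
  match i with
  | 0 => exact h
  | 1 => exact h
  | i + 2 => exact Real.rpow_nonneg zero_le_two _

/-- This absorbs the loss of 1 in passing from a Ramsey number to the largest `N` for which the
arrow fails. -/
theorem tower_add_one_le {x : ℝ} (h : 1 ≤ x) (i : ℕ) : tower i x + 1 ≤ tower i (2 * x) := by
  induction i with
  | zero => change x + 1 ≤ 2 * x; linarith
  | succ i ih =>
    cases i with
    | zero => change x + 1 ≤ 2 * x; linarith
    | succ i =>
      have h₁ : (1 : ℝ) ≤ 2 ^ tower (i + 1) x :=
        Real.one_le_rpow one_le_two (tower_nonneg (by linarith) _)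
      calc (2 : ℝ) ^ tower (i + 1) x + 1 ≤ 2 ^ (tower (i + 1) x + 1) := by
            rw [Real.rpow_add zero_lt_two, Real.rpow_one]; linarith
        _ ≤ _ := Real.rpow_le_rpow_of_exponent_le one_le_two ih

theorem le_two_rpow {x : ℝ} (h : 0 ≤ x) : x ≤ (2 : ℝ) ^ x := by
  have h₁ : ((⌊x⌋₊ : ℝ) + 1) ≤ 2 ^ ⌊x⌋₊ := by exact_mod_cast Nat.lt_two_pow_self
  calc x ≤ ⌊x⌋₊ + 1 := (Nat.lt_floor_add_one x).le
    _ ≤ 2 ^ ⌊x⌋₊ := h₁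
    _ = (2 : ℝ) ^ (⌊x⌋₊ : ℝ) := (Real.rpow_natCast _ _).symm
    _ ≤ _ := Real.rpow_le_rpow_of_exponent_le one_le_two (Nat.floor_le h)

theorem le_tower {x : ℝ} (h : 0 ≤ x) (i : ℕ) : x ≤ tower i x := by
  induction i with
  | zero => exact le_rfl
  | succ i ih =>
    cases i with
    | zero => exact le_rfl
    | succ i => exact ih.trans (le_two_rpow (tower_nonneg h _))

/-! ### Iterating the step: the explicit lower bound. -/

theorem natCeil_five_halves_mul (k : ℕ) : ⌈(5 / 2 : ℝ) * (k : ℝ)⌉₊ = (5 * k + 1) / 2 := by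
  apply le_antisymm
  · rw [Nat.ceil_le]
    have : 5 * k ≤ 2 * ((5 * k + 1) / 2) := by omega
    have : (5 : ℝ) * k ≤ 2 * ((5 * k + 1) / 2 : ℕ) := by exact_mod_cast this
    linarith
  · have h := Nat.le_ceil ((5 / 2 : ℝ) * (k : ℝ))
    have h' : (5 : ℝ) * k ≤ 2 * (⌈(5 / 2 : ℝ) * (k : ℝ)⌉₊ : ℝ) := by linarith
    have : 5 * k ≤ 2 * ⌈(5 / 2 : ℝ) * (k : ℝ)⌉₊ := by exact_mod_cast h'
    omega

theorem exists_not_ramseyArrow_of_three {N m : ℕ} {x : ℝ} (hm : 4 ≤ m)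
    (h : ¬ RamseyArrow N 3 4 m) (hx : (2 : ℝ) ^ x ≤ N) (k : ℕ) (hk : 4 ≤ k) :
    ∃ N' : ℕ, tower (k - 1) x ≤ N' ∧
      ¬ RamseyArrow N' k ((5 * k + 1) / 2 - 3) (2 * m - 1 + ((5 * k + 1) / 2 - 10)) := by
  have hpow : ∀ (T : ℝ) (N : ℕ), T ≤ N → (2 : ℝ) ^ T ≤ (2 ^ N : ℕ) := by
    intro T N hT
    push_cast
    rw [← Real.rpow_natCast]
    exact Real.rpow_le_rpow_of_exponent_le one_le_two hT
  induction k, hk using Nat.le_induction with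
  | base =>
    exact ⟨2 ^ N, hpow _ _ hx, not_ramseyArrow_two_pow (by norm_num)
      (forces_three (n := 4) (by norm_num)) (forces_three (by omega)) h⟩
  | succ k hk ih =>
    obtain ⟨N', hT, hN'⟩ := ih
    refine ⟨2 ^ N', ?_, ?_⟩
    · obtain ⟨i, rfl⟩ : ∃ i, k = i + 2 := ⟨k - 2, by omega⟩
      exact hpow _ _ hT
    · rcases Nat.even_or_odd k with he | ho
      · have := not_ramseyArrow_two_pow (by omega)
          (forces_add_three hk (by omega)) (forces_add_three hk (by omega)) hN'
        obtain ⟨l, rfl⟩ := he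
        convert this using 2 <;> omega
      · have := not_ramseyArrow_two_pow (by omega)
          (forces_add_two hk ho (by omega)) (forces_add_two hk ho (by omega)) hN'
        obtain ⟨l, rfl⟩ := ho
        convert this using 2 <;> omega

theorem exists_tower_le_ramseyNumber : ∃ c : ℝ, 0 < c ∧ ∀ k : ℕ, 4 ≤ k → ∀ s : ℕ,
    ⌈(5 / 2 : ℝ) * (k : ℝ)⌉₊ - 3 ≤ s → ∀ n : ℕ, 3 * k ≤ n →
      tower (k - 1) (c * n * Real.log n) ≤ (ramseyNumber k s n : ℝ) := by
  obtain ⟨c, hc, hbase⟩ := exists_not_ramseyArrow_three_four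
  refine ⟨c / 36, by positivity, fun k hk s hs n hn => ?_⟩
  rw [natCeil_five_halves_mul] at hs
  -- The largest `m` for which the iterated blue size `2 * m - 1 + ((5 * k + 1) / 2 - 10)` is at
  -- most `n`. The factor 36 is 12 · 3, from `n ≤ 12 * m` and `log n ≤ 3 * log m`.
  obtain ⟨m, hm⟩ : ∃ m, m = (n + 11 - (5 * k + 1) / 2) / 2 := ⟨_, rfl⟩
  have hm6 : 6 ≤ m := by omega
  have hnm : n ≤ 12 * m := by omega
  obtain ⟨N, hN, hN'⟩ := hbase m (by omega)
  obtain ⟨N', hT, hA⟩ := exists_not_ramseyArrow_of_three (by omega) hN' hN k hk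
  have hA' : ¬ RamseyArrow N' k s n := fun h => hA (h.mono le_rfl hs (by omega))
  have hn0 : (0 : ℝ) < n := by exact_mod_cast (by omega : 0 < n)
  have hnm' : (n : ℝ) ≤ 12 * m := by exact_mod_cast hnm
  have hlog : Real.log n ≤ 3 * Real.log m := by
    have h3 : n ≤ m ^ 3 := by nlinarith [Nat.mul_le_mul hm6 hm6]
    have := Real.log_le_log hn0 (by exact_mod_cast h3 : (n : ℝ) ≤ (m : ℝ) ^ 3)
    rw [Real.log_pow] at this
    exact_mod_cast this
  have hmul : (n : ℝ) * Real.log n ≤ 12 * m * (3 * Real.log m) :=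
    mul_le_mul hnm' hlog (Real.log_nonneg (by exact_mod_cast (by omega : 1 ≤ n))) (by positivity)
  calc tower (k - 1) (c / 36 * n * Real.log n) ≤ tower (k - 1) (c * m * Real.log m) := by
        refine tower_mono ?_ _
        have := mul_le_mul_of_nonneg_left hmul hc.le
        linarith
    _ ≤ N' := hT
    _ ≤ _ := by exact_mod_cast (lt_ramseyNumber hA').le

/-! ### Growth rates and the threshold s(k). -/

theorem ramseyNumber_le_of_le {k s : ℕ} (hs : s ≤ k) (n : ℕ) :
    ramseyNumber k s n ≤ n := by
  refine Nat.sInf_le fun χ => ?_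
  by_cases h : ∃ e : Finset (Fin n), e.card = k ∧ χ e = true
  · obtain ⟨e, he, hχ⟩ := h
    obtain ⟨A, hAe, hA⟩ := Finset.exists_subset_card_eq (hs.trans he.ge)
    refine Or.inl ⟨A, hA, fun e' he' hc => ?_⟩
    rwa [Finset.eq_of_subset_of_card_le (he'.trans hAe) (by omega)]
  · push Not at h
    exact Or.inr ⟨Finset.univ, by simp, fun e _ hc => by simpa using h e hc⟩

/-- For `s ≤ k` the Ramsey number is at most `n`, which is too small. This supplies the size
condition on `s` in the stepping-up lemmas. -/
theorem GrowsAsTower.lt {k s : ℕ} (h : GrowsAsTower k s) : k < s := by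
  by_contra! hs
  obtain ⟨c, hc, n₀, h⟩ := h
  obtain ⟨n₁, hn₁⟩ := Filter.eventually_atTop.1
    ((Real.tendsto_log_atTop.comp tendsto_natCast_atTop_atTop).eventually_gt_atTop (1 / c))
  obtain ⟨n, hn⟩ : ∃ n, n = max (max n₀ n₁) (k + 1) := ⟨_, rfl⟩
  have hlog : 1 / c < Real.log n := hn₁ n (by omega)
  have h₁ := h n (by omega)
  have h₂ : (ramseyNumber k s n : ℝ) ≤ n := by
    exact_mod_cast ramseyNumber_le_of_le hs n
  have hn0 : (0 : ℝ) < n := by exact_mod_cast (by omega : 0 < n)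
  have h₃ : (n : ℝ) < c * n * Real.log n := by
    rw [div_lt_iff₀ hc] at hlog
    nlinarith
  have h₄ := le_tower (hn0.le.trans h₃.le) (k - 1)
  linarith

theorem GrowsAsTower.succ {k s d : ℕ} (hk : 2 ≤ k) (hd : d ≤ 3) (h : GrowsAsTower k s)
    (hstep : ∀ N n, k + 1 ≤ n → ¬ RamseyArrow N k s n →
      ¬ RamseyArrow (2 ^ N) (k + 1) (s + d) (n + d)) : GrowsAsTower (k + 1) (s + d) := by
  obtain ⟨c, hc, n₀, h⟩ := h
  obtain ⟨n₁, hn₁⟩ := exists_nat_ge (8 / c)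
  -- The factor 8 is 2 · 2 for replacing `m + d` by `m` in `n log n`, and 2 more for
  -- `tower_add_one_le`.
  refine ⟨c / 8, by positivity, n₀ + n₁ + k + 6, fun n hn => ?_⟩
  obtain ⟨m, rfl⟩ : ∃ m, n = m + d := ⟨n - d, by omega⟩
  have hn0 : (0 : ℝ) < (m + d : ℕ) := by exact_mod_cast (by omega : 0 < m + d)
  have hlog1 : 1 ≤ Real.log (m + d : ℕ) := by
    rw [Real.le_log_iff_exp_le hn0]
    have h₁ := Real.exp_one_lt_d9
    have h₂ : (3 : ℝ) ≤ (m + d : ℕ) := by exact_mod_cast (by omega : 3 ≤ m + d)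
    linarith
  have hlog : Real.log (m + d : ℕ) ≤ 2 * Real.log m := by
    have h₂ : m + d ≤ m ^ 2 := by nlinarith [(by omega : 3 ≤ m)]
    have := Real.log_le_log hn0 (by exact_mod_cast h₂ : ((m + d : ℕ) : ℝ) ≤ (m : ℝ) ^ 2)
    rw [Real.log_pow] at this
    exact_mod_cast this
  have hm : ((m + d : ℕ) : ℝ) ≤ 2 * m := by exact_mod_cast (by omega : m + d ≤ 2 * m)
  obtain ⟨y, hy⟩ : ∃ y, y = c / 8 * (m + d : ℕ) * Real.log (m + d : ℕ) := ⟨_, rfl⟩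
  have hy1 : 1 ≤ y := by
    have h₁ : (n₁ : ℝ) ≤ (m + d : ℕ) := by exact_mod_cast (by omega : n₁ ≤ m + d)
    have h₂ : 1 ≤ c / 8 * (m + d : ℕ) := by
      have := hn₁.trans h₁
      rw [div_le_iff₀ hc] at this
      linarith
    rw [hy]
    nlinarith
  have hy2 : 2 * y ≤ c * m * Real.log m := by
    have hmul : ((m + d : ℕ) : ℝ) * Real.log (m + d : ℕ) ≤ 2 * m * (2 * Real.log m) :=
      mul_le_mul hm hlog (by linarith) (by positivity)
    have := mul_le_mul_of_nonneg_left hmul hc.le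
    rw [hy]
    linarith
  have hr : tower (k - 1) y + 1 ≤ (ramseyNumber k s m : ℝ) :=
    (tower_add_one_le hy1 _).trans ((tower_mono hy2 _).trans (h m (by omega)))
  have hr1 : 1 ≤ ramseyNumber k s m := by
    have := tower_nonneg (zero_le_one.trans hy1) (k - 1)
    exact_mod_cast (by linarith : (1 : ℝ) ≤ ramseyNumber k s m)
  obtain ⟨N, hN⟩ : ∃ N, ramseyNumber k s m = N + 1 := ⟨_, (Nat.sub_add_cancel hr1).symm⟩
  have hA := lt_ramseyNumber
    (hstep N m (by omega) (not_ramseyArrow_of_lt (hN ▸ Nat.lt_succ_self N)))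
  rw [← hy]
  obtain ⟨i, rfl⟩ : ∃ i, k = i + 2 := ⟨k - 2, by omega⟩
  calc tower (i + 2 + 1 - 1) y = (2 : ℝ) ^ tower (i + 1) y := rfl
    _ ≤ (2 : ℝ) ^ (N : ℝ) := by
        refine Real.rpow_le_rpow_of_exponent_le one_le_two ?_
        rw [hN] at hr
        push_cast at hr
        simpa using hr
    _ = ((2 ^ N : ℕ) : ℝ) := by rw [Real.rpow_natCast]; push_cast; rfl
    _ ≤ _ := by exact_mod_cast hA.le

theorem towerThreshold_le {k s : ℕ} (h : GrowsAsTower k s) : towerThreshold k ≤ s :=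
  iInf₂_le s h

theorem towerThreshold_succ_le {k d : ℕ}
    (h : ∀ s, GrowsAsTower k s → GrowsAsTower (k + 1) (s + d)) :
    towerThreshold (k + 1) ≤ towerThreshold k + d := by
  -- With `d` subtracted on the left, the bound can be checked on each member of the infimum; an
  -- infinite threshold needs no separate case.
  rw [← tsub_le_iff_right]
  refine le_iInf₂ fun s hs => ?_
  rw [tsub_le_iff_right]
  exact_mod_cast towerThreshold_le (h s hs)

theorem mainTheorem6 :
    (∃ c : ℝ, 0 < c ∧ ∀ k : ℕ, 4 ≤ k → ∀ s : ℕ, ⌈(5 / 2 : ℝ) * (k : ℝ)⌉₊ - 3 ≤ s →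
      ∀ n : ℕ, 3 * k ≤ n →
        tower (k - 1) (c * n * Real.log n) ≤ (ramseyNumber k s n : ℝ)) ∧
    (∀ k : ℕ, 4 ≤ k → towerThreshold k ≤ ((⌈(5 / 2 : ℝ) * (k : ℝ)⌉₊ - 3 : ℕ) : ℕ∞)) ∧
    towerThreshold 4 ≤ 7 ∧
    (∀ k : ℕ, 4 ≤ k → towerThreshold (k + 1) ≤ towerThreshold k + 3) ∧
    (∀ k : ℕ, 4 ≤ k → Odd k → towerThreshold (k + 1) ≤ towerThreshold k + 2) := by
  obtain ⟨c, hc, h⟩ := exists_tower_le_ramseyNumber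
  have hle : ∀ k : ℕ, 4 ≤ k →
      towerThreshold k ≤ ((⌈(5 / 2 : ℝ) * (k : ℝ)⌉₊ - 3 : ℕ) : ℕ∞) := fun k hk =>
    towerThreshold_le ⟨c, hc, 3 * k, h k hk _ le_rfl⟩
  refine ⟨⟨c, hc, h⟩, hle, ?_, fun k hk => ?_, fun k hk hodd => ?_⟩
  · have := hle 4 le_rfl
    rw [natCeil_five_halves_mul] at this
    exact_mod_cast this
  · refine towerThreshold_succ_le (d := 3) fun s hs => ?_
    refine hs.succ (by omega) le_rfl fun N n hn hN => ?_
    exact not_ramseyArrow_two_pow (by omega) (forces_add_three hk hs.lt.le)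
      (forces_add_three hk (by omega)) hN
  · refine towerThreshold_succ_le (d := 2) fun s hs => ?_
    refine hs.succ (by omega) (by norm_num) fun N n hn hN => ?_
    exact not_ramseyArrow_two_pow (by omega) (forces_add_two hk hodd hs.lt)
      (forces_add_two hk hodd hn) hN
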